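/- **Definitions.** All categories are finitely complete. For a map $f:X\to Y$, $R[f]$ denotes its kernel equivalence relation, with projections $d_0^f,d_1^f:R[f]\to X$ and diagonal $s_0^f:X\to R[f]$. All statements "with elements" are about generalized elements. * A category $\mathbb E$ is a *Gumm category* if the Shifting Lemma holds in it: for all internal equivalence relations $T,S,R$ on an object with $R\cap S\subset T$, if $x\,S\,y$, $x'\,S\,y'$, $x\,R\,x'$, $y\,R\,y'$ and $x\,T\,x'$, then $y\,T\,y'$. It is *regular* if kernel equivalence relations have coequalizers and regular epimorphisms are stable under pullback. * $Pt_Y\mathbb E$ is the pointed category whose objects are the split epimorphisms $(f,s):X\rightleftarrows Y$ (that is, $f s=1_Y$) and whose maps are the maps $X\to X'$ commuting with the epimorphisms and with the sections. * For equivalence relations $R,S$ on $X$, $R\square S$ is the object of quadruples $(x,y,t,z)$ with $xRy$, $tRz$, $xSt$, $ySz$; $R\times_1S$ is the object of triples $(x,y,z)$ with $xRySz$; and $\zeta_{R,S}:R\square S\to R\times_1S$ sends $(x,y,t,z)$ to $(x,y,z)$. A relation $(\pi_0,\pi_1):W\rightarrowtail X\times Z$ is *difunctional* if $R[\pi_0]\cap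 R[\pi_1]$ is the diagonal $\Delta_W$ and $\zeta_{R[\pi_0],R[\pi_1]}$ is an isomorphism. In a pointed category it is *right punctual* if $\pi_1$ has a section $t$ with $\pi_0t=0$. * A pointed category satisfies *Axiom $\ast$* if, for every right punctual difunctional relation $(\pi_0,\pi_1):W\rightarrowtail X\times Z$ and every equivalence relation $T$ on $W$, the map $\zeta_{R[\pi_0],T}$ is an extremal epimorphism. * The *diagonal punctuation* of an object $X$ of a pointed category is, when it exists, the pushout $\omega_X:X\times X\to Dp\,X$ of the diagonal $X\to X\times X$ along $X\to 1=0$. A pointed category *admits diagonal punctuations* if every object has one. * An object $X$ of a pointed category is *abelian* if it carries an internal subtraction $d:X\times X\to X$, i.e. $d(x,x)=0$ and $d(x,0)=x$. An *abelian split epimorphism above $Y$* is an abelian object of $Pt_Y\mathbb E$. **Theorem.** Let $\mathbb E$ be a regular Gumm category such that every fibre $Pt_Y\mathbb E$ satisfies Axiom $\ast$ and admits diagonal punctuations. 1. Let $(f,s):X\rightleftarrows Y$ be any split epimorphism, and let $\omega_f$ be its diagonal punctuation in $Pt_Y\mathbb E$, with values in the split epimorphism $(\psi_f,\theta_f):Dp[f]\rightleftarrows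 Y$. The product of $(f,s)$ with itself in $Pt_Y\mathbb E$ is $R[f]$, and the square $$\begin{array}{ccc} R[f] & \xrightarrow{\ \omega_f\ } & Dp[f]\\ {\scriptstyle s_0^f}\uparrow & & \uparrow{\scriptstyle \theta_f}\\ X & \xrightarrow{\ f\ } & Y\end{array}$$ is a pushout in $\mathbb E$ with $\omega_f$ a regular epimorphism. Moreover $(\psi_f,\theta_f)$ is the universal abelian split epimorphism associated with $(f,s)$: it is abelian, and every map of $Pt_Y\mathbb E$ from $(f,s)$ to an abelian split epimorphism $(g,t)$ above $Y$ factors, by a unique map $(\psi_f,\theta_f)\to(g,t)$ of $Pt_Y\mathbb E$, through the comparison $\omega_f\circ(sf,1_X):(f,s)\to(\psi_f,\theta_f)$. 2. For every object $Y$, the abelian split epimorphisms above $Y$ are stable under monomorphisms in $Pt_Y\mathbb E$: if $U\rightarrowtail A$ is a monomorphism of $Pt_Y\mathbb E$ and $A$ is abelian, then $U$ is abelian. -/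

import Mathlib

open CategoryTheory CategoryTheory.Limits

namespace GummCat

universe v u

section Relations

/-- For a pair of parallel maps `d₀ d₁ : R ⟶ X` (a relation on `X`), the generalized elements
`x y : A ⟶ X` are related: `x R y`. -/
def Rel {C : Type u} [Category.{v} C] {R X A : C} (d₀ d₁ : R ⟶ X) (x y : A ⟶ X) : Prop :=
  ∃ r : A ⟶ R, r ≫ d₀ = x ∧ r ≫ d₁ = y

/-- A Gumm category: the Shifting Lemma holds for all triples `(T, S, R)` of internal equivalence
relations on an object `X` with `R ∩ S ⊆ T` (expressed with generalized elements): if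
`x S y`, `x' S y'`, `x R x'`, `y R y'` and `x T x'`, then `y T y'`. -/
def IsGumm (C : Type u) [Category.{v} C] : Prop :=
  ∀ ⦃X R S T : C⦄ (r₀ r₁ : R ⟶ X) (s₀ s₁ : S ⟶ X) (t₀ t₁ : T ⟶ X),
    IsEquivalenceRelation r₀ r₁ → IsEquivalenceRelation s₀ s₁ → IsEquivalenceRelation t₀ t₁ →
    (∀ ⦃A : C⦄ (x y : A ⟶ X), Rel r₀ r₁ x y → Rel s₀ s₁ x y → Rel t₀ t₁ x y) →
    ∀ ⦃A : C⦄ (x y x' y' : A ⟶ X),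
      Rel s₀ s₁ x y → Rel s₀ s₁ x' y' → Rel r₀ r₁ x x' → Rel r₀ r₁ y y' →
      Rel t₀ t₁ x x' → Rel t₀ t₁ y y'

/-- `Q` is the square construction `R □ S` of two relations on `X`, i.e. the inverse image of
`S × S` along `(r₀, r₁) : R ⟶ X × X`. A generalized element of `Q` is a quadruple `(x, y, t, z)`
with `x R y` (given by `a`), `t R z` (given by `a'`), `x S t` (given by `b`) and `y S z`
(given by `b'`). -/
structure IsSquareObj {C : Type u} [Category.{v} C] {X R S Q : C}
    (r₀ r₁ : R ⟶ X) (s₀ s₁ : S ⟶ X) (a a' : Q ⟶ R) (b b' : Q ⟶ S) : Prop where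
  eq_x : a ≫ r₀ = b ≫ s₀
  eq_y : a ≫ r₁ = b' ≫ s₀
  eq_t : a' ≫ r₀ = b ≫ s₁
  eq_z : a' ≫ r₁ = b' ≫ s₁
  existsUnique_lift : ∀ ⦃A : C⦄ (u u' : A ⟶ R) (w w' : A ⟶ S),
    u ≫ r₀ = w ≫ s₀ → u ≫ r₁ = w' ≫ s₀ → u' ≫ r₀ = w ≫ s₁ → u' ≫ r₁ = w' ≫ s₁ →
    ∃! q : A ⟶ Q, q ≫ a = u ∧ q ≫ a' = u' ∧ q ≫ b = w ∧ q ≫ b' = w'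

/-- The forgetful factorization `ζ_{R,S} : R □ S ⟶ R ×₁ S`, `(x, y, t, z) ↦ (x R y S z)`, where
`P = R ×₁ S` is the pullback of `r₁` and `s₀`. -/
noncomputable def zeta {C : Type u} [Category.{v} C] {X R S Q P : C}
    {r₀ r₁ : R ⟶ X} {s₀ s₁ : S ⟶ X} {a a' : Q ⟶ R} {b b' : Q ⟶ S} {p : P ⟶ R} {q : P ⟶ S}
    (hQ : IsSquareObj r₀ r₁ s₀ s₁ a a' b b') (hP : IsPullback p q r₁ s₀) : Q ⟶ P :=
  hP.lift a b' hQ.eq_y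

/-- Sharp intersection of two equivalence relations `R` and `S` on `X`: `R ∩ S` is the diagonal
and `ζ_{R,S}` is an isomorphism. -/
def IsSharp {C : Type u} [Category.{v} C] {X R S : C}
    (r₀ r₁ : R ⟶ X) (s₀ s₁ : S ⟶ X) : Prop :=
  (∀ ⦃A : C⦄ (x y : A ⟶ X), Rel r₀ r₁ x y → Rel s₀ s₁ x y → x = y) ∧
  ∀ ⦃Q P : C⦄ (a a' : Q ⟶ R) (b b' : Q ⟶ S) (p : P ⟶ R) (q : P ⟶ S)
    (hQ : IsSquareObj r₀ r₁ s₀ s₁ a a' b b') (hP : IsPullback p q r₁ s₀), IsIso (zeta hQ hP)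

/-- The relation `(f, g) : W ⟶ X × Z` is difunctional: the kernel equivalence relations
`R[f]` and `R[g]` have a sharp intersection. -/
def IsDifunctional {C : Type u} [Category.{v} C] {W X Z : C} (f : W ⟶ X) (g : W ⟶ Z) : Prop :=
  ∀ ⦃K L : C⦄ (k₀ k₁ : K ⟶ W) (l₀ l₁ : L ⟶ W),
    IsKernelPair f k₀ k₁ → IsKernelPair g l₀ l₁ → IsSharp k₀ k₁ l₀ l₁

end Relations

section Pointed

/-- A span `(f, g)` in a pointed category is right punctual when `g` has a section `t`
with `f.t = 0`. -/
def IsRightPunctual {D : Type u} [Category.{v} D] [HasZeroMorphisms D] {W X Z : D}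
    (f : W ⟶ X) (g : W ⟶ Z) : Prop :=
  ∃ t : Z ⟶ W, t ≫ g = 𝟙 Z ∧ t ≫ f = 0

/-- Axiom `∗` for a (finitely complete) pointed category: for any right punctual difunctional
relation `W` between `X` and `Z`, and any equivalence relation `T` on `W`, the factorization
`ζ_{R[π₀],T} : R[π₀] □ T ⟶ R[π₀] ×₁ T` is an extremal epimorphism. -/
def AxiomStar (D : Type u) [Category.{v} D] [HasZeroMorphisms D] : Prop :=
  ∀ ⦃X Z W T K : D⦄ (π₀ : W ⟶ X) (π₁ : W ⟶ Z) (t₀ t₁ : T ⟶ W) (k₀ k₁ : K ⟶ W),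
    JointlyMono₂ π₀ π₁ → IsRightPunctual π₀ π₁ → IsDifunctional π₀ π₁ →
    IsEquivalenceRelation t₀ t₁ → IsKernelPair π₀ k₀ k₁ →
    ∀ ⦃Q P : D⦄ (a a' : Q ⟶ K) (b b' : Q ⟶ T) (p : P ⟶ K) (q : P ⟶ T)
      (hQ : IsSquareObj k₀ k₁ t₀ t₁ a a' b b') (hP : IsPullback p q k₁ t₀),
      ExtremalEpi (zeta hQ hP)

open scoped ZeroObject in
/-- `ω : X × X ⟶ Dp` exhibits `Dp` as the diagonal punctuation of `X`: the pushout of the diagonal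
`s₀ : X ⟶ X × X` along the terminal map `X ⟶ 1` (in a pointed category, `1 = 0`). -/
structure IsDiagonalPunctuation {D : Type u} [Category.{v} D] [HasZeroObject D]
    [HasZeroMorphisms D] {X XX Dp : D}
    (p₀ p₁ : XX ⟶ X) (s₀ : X ⟶ XX) (ω : XX ⟶ Dp) : Prop where
  isProduct : Nonempty (IsLimit (BinaryFan.mk p₀ p₁))
  s₀_p₀ : s₀ ≫ p₀ = 𝟙 X
  s₀_p₁ : s₀ ≫ p₁ = 𝟙 X
  isPushout : IsPushout s₀ (0 : X ⟶ (0 : D)) ω (0 : (0 : D) ⟶ Dp)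

/-- Every object has a diagonal punctuation. -/
def HasDiagonalPunctuations (D : Type u) [Category.{v} D] [HasZeroObject D]
    [HasZeroMorphisms D] : Prop :=
  ∀ X : D, ∃ (XX Dp : D) (p₀ p₁ : XX ⟶ X) (s₀ : X ⟶ XX) (ω : XX ⟶ Dp),
    IsDiagonalPunctuation p₀ p₁ s₀ ω

/-- An internal subtraction on `X`: a binary operation `d : X × X ⟶ X` with `d(x, x) = 0` and
`d(x, 0) = x` (the generalized element `u = (x, y)` of `X × X` has components
`u ≫ p₀` and `u ≫ p₁`). -/
structure Subtraction {D : Type u} [Category.{v} D] [HasZeroMorphisms D] (X : D) where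
  XX : D
  p₀ : XX ⟶ X
  p₁ : XX ⟶ X
  isProduct : IsLimit (BinaryFan.mk p₀ p₁)
  d : XX ⟶ X
  d_self : ∀ ⦃A : D⦄ (u : A ⟶ XX), u ≫ p₀ = u ≫ p₁ → u ≫ d = 0
  d_zero : ∀ ⦃A : D⦄ (u : A ⟶ XX), u ≫ p₁ = 0 → u ≫ d = u ≫ p₀

/-- An object of a pointed category is abelian when it carries a subtraction. -/
def IsAbelian {D : Type u} [Category.{v} D] [HasZeroMorphisms D] (X : D) : Prop :=
  Nonempty (Subtraction X)

/-- `η : X ⟶ U` is the universal comparison of `X` with the abelian objects: `U` is a reflection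
of `X` in the full subcategory of abelian objects. -/
structure IsUniversalAbelian {D : Type u} [Category.{v} D] [HasZeroMorphisms D] {X U : D}
    (η : X ⟶ U) : Prop where
  isAbelian : IsAbelian U
  existsUnique_desc : ∀ ⦃A : D⦄, IsAbelian A → ∀ h : X ⟶ A, ∃! k : U ⟶ A, η ≫ k = h

end Pointed

section Points

/-- Objects of the fibre `Pt_Y C`: split epimorphisms above `Y` with a given splitting. -/
structure Pt {C : Type u} [Category.{v} C] (Y : C) where
  obj : C
  π : obj ⟶ Y
  σ : Y ⟶ obj
  σ_π : σ ≫ π = 𝟙 Y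

/-- Morphisms of the fibre `Pt_Y C`. -/
@[ext]
structure Pt.Hom {C : Type u} [Category.{v} C] {Y : C} (P Q : Pt Y) where
  hom : P.obj ⟶ Q.obj
  hom_π : hom ≫ Q.π = P.π
  σ_hom : P.σ ≫ hom = Q.σ

instance Pt.category {C : Type u} [Category.{v} C] (Y : C) : Category.{v} (Pt Y) where
  Hom P Q := Pt.Hom P Q
  id P := ⟨𝟙 P.obj, Category.id_comp _, Category.comp_id _⟩
  comp f g := ⟨f.hom ≫ g.hom, by rw [Category.assoc, g.hom_π, f.hom_π],
    by rw [← Category.assoc, f.σ_hom, g.σ_hom]⟩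
  id_comp f := Pt.Hom.ext (Category.id_comp f.hom)
  comp_id f := Pt.Hom.ext (Category.comp_id f.hom)
  assoc f g h := Pt.Hom.ext (Category.assoc f.hom g.hom h.hom)

instance Pt.hasZeroMorphisms {C : Type u} [Category.{v} C] (Y : C) :
    HasZeroMorphisms (Pt Y) where
  zero P Q := ⟨⟨P.π ≫ Q.σ, by rw [Category.assoc, Q.σ_π, Category.comp_id],
    by rw [← Category.assoc, P.σ_π, Category.id_comp]⟩⟩
  comp_zero {P Q} f R := Pt.Hom.ext (by
    change f.hom ≫ Q.π ≫ R.σ = P.π ≫ R.σ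
    rw [← Category.assoc, f.hom_π])
  zero_comp P {Q R} g := Pt.Hom.ext (by
    change (P.π ≫ Q.σ) ≫ g.hom = P.π ≫ R.σ
    rw [Category.assoc, g.σ_hom])

/-- The zero object `(1_Y, 1_Y)` of `Pt_Y C`. -/
def Pt.zeroObj {C : Type u} [Category.{v} C] (Y : C) : Pt Y :=
  ⟨Y, 𝟙 Y, 𝟙 Y, Category.comp_id _⟩

instance Pt.hasZeroObject {C : Type u} [Category.{v} C] (Y : C) : HasZeroObject (Pt Y) :=
  ⟨⟨Pt.zeroObj Y, (IsZero.iff_id_eq_zero _).2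
    (Pt.Hom.ext (Category.comp_id (𝟙 Y)).symm)⟩⟩

end Points

end GummCat

/-!
Let `X` be an object of a pointed regular category satisfying Axiom `∗`, and let `h : X × X ⟶ V`
kill the diagonal. The product relation `X × X` is right punctual and difunctional, so Axiom `∗`
for the kernel pair of `h` lets one replace `(x, y)`, up to a regular epimorphism, by some `(0, z)`
with `h(x, y) = h(0, z)`: start from the fact that `(x, x)` and `(0, 0)` have the same image and
transport along `fst`. Two consequences follow.

* If `A` is abelian with subtraction `d` and `m : U ⟶ A` is a monomorphism, then taking
  `h = d (m × m)` makes the differences of elements of `U` locally elements of `U`, so `d` restricts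
  to `U` by diagonal fill-in.
* For the diagonal punctuation `ω : X × X ⟶ Dp`, the comparison `η = ω (0, 1)` is a regular
  epimorphism, hence so is `η × η`. In a Gumm category `ω` factors through `η × η`: if
  `ω(0, x) = ω(0, x')`, then the Shifting Lemma for the two product projections and `R[ω]` gives
  `ω(x', x) = ω(x', x') = ω(x, x)`, and then `ω(x, y) = ω(x', y)`. The factorization is the
  subtraction on `Dp`, and universality of `η` is that of the pushout.

The theorem is this argument in the fibre `Pt_Y C`, which is regular and Gumm because its forgetful
functor to `C` preserves pullbacks and creates coequalizers, and because equivalence relations in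
`Pt_Y C` have underlying equivalence relations in `C`.
-/

namespace GummCat

universe v u v' u'

attribute [local simp] prod.lift_fst prod.lift_snd

section KernelPairs

variable {C : Type u} [Category.{v} C]

theorem rel_iff_of_isKernelPair {X Y R : C} {f : X ⟶ Y} {r₀ r₁ : R ⟶ X}
    (h : IsKernelPair f r₀ r₁) {A : C} (x y : A ⟶ X) : Rel r₀ r₁ x y ↔ x ≫ f = y ≫ f := by
  refine ⟨?_, fun e => ⟨h.lift x y e, h.lift_fst _ _ _, h.lift_snd _ _ _⟩⟩
  rintro ⟨r, rfl, rfl⟩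
  simp [h.w]

variable [HasPullbacks C]

theorem isEquivalenceRelation_of_isKernelPair {X Y R : C} {f : X ⟶ Y} {r₀ r₁ : R ⟶ X}
    (h : IsKernelPair f r₀ r₁) : IsEquivalenceRelation r₀ r₁ :=
  (IsKernelPair.equivalenceRelation f r₀ r₁ (pullbackIsPullback r₁ r₀) h).isEquivalenceRelation

theorem IsGumm.shift (hG : IsGumm C) {W X Y Z : C} {f : W ⟶ X} {g : W ⟶ Y} {h : W ⟶ Z}
    (hfg : ∀ ⦃A : C⦄ (x y : A ⟶ W), x ≫ f = y ≫ f → x ≫ g = y ≫ g → x ≫ h = y ≫ h)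
    {A : C} {x y x' y' : A ⟶ W} (hx : x ≫ g = y ≫ g) (hx' : x' ≫ g = y' ≫ g)
    (hf : x ≫ f = x' ≫ f) (hf' : y ≫ f = y' ≫ f) (hh : x ≫ h = x' ≫ h) :
    y ≫ h = y' ≫ h := by
  have kf := IsKernelPair.of_hasPullback f
  have kg := IsKernelPair.of_hasPullback g
  have kh := IsKernelPair.of_hasPullback h
  have shifting := hG _ _ _ _ _ _ (isEquivalenceRelation_of_isKernelPair kf)
    (isEquivalenceRelation_of_isKernelPair kg) (isEquivalenceRelation_of_isKernelPair kh)
  simp only [rel_iff_of_isKernelPair kf, rel_iff_of_isKernelPair kg,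
    rel_iff_of_isKernelPair kh] at shifting
  exact shifting hfg x y x' y' hx hx' hf hf' hh

variable [HasBinaryProducts C] {A X Y V : C}

theorem IsGumm.lift_comp_eq_of_snd (hG : IsGumm C) (h : X ⨯ Y ⟶ V) {x x' : A ⟶ X} {y y' : A ⟶ Y}
    (e : prod.lift x y ≫ h = prod.lift x y' ≫ h) :
    prod.lift x' y ≫ h = prod.lift x' y' ≫ h :=
  hG.shift (f := prod.fst) (g := prod.snd) (x := prod.lift x y) (y := prod.lift x' y)
    (x' := prod.lift x y') (y' := prod.lift x' y') (fun _ _ _ h₀ h₁ => by rw [prod.hom_ext h₀ h₁])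
    (by simp) (by simp) (by simp) (by simp) e

theorem IsGumm.lift_comp_eq_of_fst (hG : IsGumm C) (h : X ⨯ Y ⟶ V) {x x' : A ⟶ X} {y y' : A ⟶ Y}
    (e : prod.lift x y ≫ h = prod.lift x' y ≫ h) :
    prod.lift x y' ≫ h = prod.lift x' y' ≫ h :=
  hG.shift (f := prod.snd) (g := prod.fst) (x := prod.lift x y) (y := prod.lift x y')
    (x' := prod.lift x' y) (y' := prod.lift x' y') (fun _ _ _ h₁ h₀ => by rw [prod.hom_ext h₀ h₁])
    (by simp) (by simp) (by simp) (by simp) e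

end KernelPairs

section Squares

variable {C : Type u} [Category.{v} C]

theorem exists_isSquareObj [HasFiniteLimits C] {X R S : C} (r₀ r₁ : R ⟶ X) (s₀ s₁ : S ⟶ X) :
    ∃ (Q : C) (a a' : Q ⟶ R) (b b' : Q ⟶ S), IsSquareObj r₀ r₁ s₀ s₁ a a' b b' := by
  let f := prod.lift (prod.map r₀ r₀) (prod.map r₁ r₁)
  let g := prod.map (prod.lift s₀ s₁) (prod.lift s₀ s₁)
  have hQ := IsPullback.of_hasPullback f g
  have w := hQ.w
  simp only [f, g, prod.hom_ext_iff, prod.comp_lift, prod.lift_fst, prod.lift_snd,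
    Category.assoc, prod.map_fst, prod.map_snd] at w
  obtain ⟨⟨eq_x, eq_t⟩, eq_y, eq_z⟩ := w
  refine ⟨pullback f g, pullback.fst f g ≫ prod.fst, pullback.fst f g ≫ prod.snd,
    pullback.snd f g ≫ prod.fst, pullback.snd f g ≫ prod.snd, by simpa using eq_x,
    by simpa using eq_y, by simpa using eq_t, by simpa using eq_z, ?_⟩
  intro A u u' w w' e_x e_y e_t e_z
  refine ⟨hQ.lift (prod.lift u u') (prod.lift w w')
    (by simp [f, g, e_x, e_y, e_t, e_z]), by simp, ?_⟩
  rintro q ⟨rfl, rfl, rfl, rfl⟩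
  apply hQ.hom_ext <;> apply prod.hom_ext <;> simp

theorem IsSquareObj.hom_ext {X R S Q : C} {r₀ r₁ : R ⟶ X} {s₀ s₁ : S ⟶ X} [JointlyMono₂ r₀ r₁]
    [JointlyMono₂ s₀ s₁] {a a' : Q ⟶ R} {b b' : Q ⟶ S} (hQ : IsSquareObj r₀ r₁ s₀ s₁ a a' b b')
    {A : C} {f g : A ⟶ Q} (ha : f ≫ a = g ≫ a) (ha' : f ≫ a' = g ≫ a') : f = g := by
  have hb : f ≫ b = g ≫ b := JointlyMono₂.right_cancellation (p₁ := s₀) (p₂ := s₁) _ _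
    (by simp only [Category.assoc, ← hQ.eq_x, reassoc_of% ha])
    (by simp only [Category.assoc, ← hQ.eq_t, reassoc_of% ha'])
  have hb' : f ≫ b' = g ≫ b' := JointlyMono₂.right_cancellation (p₁ := s₀) (p₂ := s₁) _ _
    (by simp only [Category.assoc, ← hQ.eq_y, reassoc_of% ha])
    (by simp only [Category.assoc, ← hQ.eq_z, reassoc_of% ha'])
  exact (hQ.existsUnique_lift (g ≫ a) (g ≫ a') (g ≫ b) (g ≫ b') (by simp [hQ.eq_x])
    (by simp [hQ.eq_y]) (by simp [hQ.eq_t]) (by simp [hQ.eq_z])).unique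
      ⟨ha, ha', hb, hb'⟩ (by simp)

section zeta

variable {X R S Q P : C} {r₀ r₁ : R ⟶ X} {s₀ s₁ : S ⟶ X} {a a' : Q ⟶ R} {b b' : Q ⟶ S}
  {p : P ⟶ R} {q : P ⟶ S} (hQ : IsSquareObj r₀ r₁ s₀ s₁ a a' b b') (hP : IsPullback p q r₁ s₀)

@[simp]
theorem zeta_comp_fst : zeta hQ hP ≫ p = a :=
  hP.lift_fst _ _ _

@[simp]
theorem zeta_comp_snd : zeta hQ hP ≫ q = b' :=
  hP.lift_snd _ _ _

end zeta

end Squares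

theorem isRegularEpi_prod_map_self {D : Type u} [Category.{v} D] [Regular D] {X Y : D} (f : X ⟶ Y)
    [IsRegularEpi f] : IsRegularEpi (prod.map f f) := by
  have (Z : D) : IsRegularEpi (prod.map f (𝟙 Z)) :=
    Regular.regularEpiIsStableUnderBaseChange.of_isPullback
      (IsPullback.of_prod_fst_with_id f Z) ‹_›
  have fac : prod.map f f =
      prod.map f (𝟙 X) ≫ (prod.braiding Y X).hom ≫ prod.map f (𝟙 Y) ≫ (prod.braiding Y Y).hom := by
    apply prod.hom_ext <;> simp [prod.lift_fst_assoc]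
  have : StrongEpi (prod.map f f) := by
    rw [fac]
    infer_instance
  infer_instance

section Star

variable {D : Type u} [Category.{v} D]

theorem isDifunctional_fst_snd [HasBinaryProducts D] (X Y : D) :
    IsDifunctional (prod.fst : X ⨯ Y ⟶ X) (prod.snd : X ⨯ Y ⟶ Y) := by
  intro K L k₀ k₁ l₀ l₁ hK hL
  refine ⟨fun A x y hx hy => prod.hom_ext ((rel_iff_of_isKernelPair hK x y).1 hx)
    ((rel_iff_of_isKernelPair hL x y).1 hy), ?_⟩
  intro Q P a a' b b' p q hQ hP
  have jK : JointlyMono₂ k₀ k₁ := ⟨fun _ _ _ h₀ h₁ => hK.hom_ext h₀ h₁⟩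
  have jL : JointlyMono₂ l₀ l₁ := ⟨fun _ _ _ h₀ h₁ => hL.hom_ext h₀ h₁⟩
  -- `(x, y, t, z)` is recovered from `(x, y, z)` as `t = (z.1, x.2)`.
  let t := prod.lift (q ≫ l₁ ≫ prod.fst) (p ≫ k₀ ≫ prod.snd)
  have : Mono (zeta hQ hP) := by
    refine ⟨fun f g e => ?_⟩
    have ha : f ≫ a = g ≫ a := by rw [← zeta_comp_fst hQ hP, reassoc_of% e]
    have hb' : f ≫ b' = g ≫ b' := by rw [← zeta_comp_snd hQ hP, reassoc_of% e]
    have hz : f ≫ a' ≫ k₁ = g ≫ a' ≫ k₁ := by rw [hQ.eq_z, reassoc_of% hb']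
    refine hQ.hom_ext ha (hK.hom_ext (prod.hom_ext ?_ ?_) (by simpa using hz))
    · simpa [hK.w] using hz =≫ prod.fst
    · simp only [Category.assoc, reassoc_of% hQ.eq_t, ← hL.w]
      rw [← reassoc_of% hQ.eq_x, reassoc_of% ha]
  obtain ⟨c, ⟨hca, -, -, hcb'⟩, -⟩ := hQ.existsUnique_lift p
    (hK.lift t (q ≫ l₁) (by simp [t])) (hL.lift (p ≫ k₀) t (by simp [t])) q
    (by simp) hP.w (by simp) (by simp)
  have : IsSplitEpi (zeta hQ hP) :=
    ⟨⟨c, hP.hom_ext (by simp [hca]) (by simp [hcb'])⟩⟩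
  exact isIso_of_mono_of_isSplitEpi _

theorem AxiomStar.exists_cover [Regular D] [HasZeroMorphisms D] (hS : AxiomStar D)
    {X Z W T A : D} {π₀ : W ⟶ X} {π₁ : W ⟶ Z} {t₀ t₁ : T ⟶ W} [JointlyMono₂ π₀ π₁]
    (hp : IsRightPunctual π₀ π₁) (hd : IsDifunctional π₀ π₁) (hT : IsEquivalenceRelation t₀ t₁)
    {a b c : A ⟶ W} (hab : a ≫ π₀ = b ≫ π₀) (hbc : Rel t₀ t₁ b c) :
    ∃ (E : D) (e : E ⟶ A) (δ : E ⟶ W),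
      IsRegularEpi e ∧ δ ≫ π₀ = e ≫ c ≫ π₀ ∧ Rel t₀ t₁ (e ≫ a) δ := by
  have hK := IsKernelPair.of_hasPullback π₀
  obtain ⟨w, rfl, rfl⟩ := hbc
  obtain ⟨Q, r, r', s, s', hQ⟩ :=
    exists_isSquareObj (pullback.fst π₀ π₀) (pullback.snd π₀ π₀) t₀ t₁
  have hP := IsPullback.of_hasPullback (pullback.snd π₀ π₀) t₀
  have : ExtremalEpi (zeta hQ hP) := hS _ _ _ _ _ _ ‹_› hp hd hT hK _ _ _ _ _ _ hQ hP
  let l := hP.lift (hK.lift a (w ≫ t₀) hab) w (by simp)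
  let u := pullback.fst (zeta hQ hP) l
  let e := pullback.snd (zeta hQ hP) l
  have hu : u ≫ zeta hQ hP = e ≫ l := pullback.condition
  have hr : u ≫ r = e ≫ hK.lift a (w ≫ t₀) hab := by
    simpa [l] using hu =≫ pullback.fst (pullback.snd π₀ π₀) t₀
  have hs' : u ≫ s' = e ≫ w := by simpa [l] using hu =≫ pullback.snd (pullback.snd π₀ π₀) t₀
  refine ⟨_, e, u ≫ r' ≫ pullback.fst π₀ π₀, inferInstance, ?_, u ≫ s, ?_, ?_⟩
  · simp only [Category.assoc, hK.w, reassoc_of% hQ.eq_z, reassoc_of% hs']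
  · rw [Category.assoc, ← hQ.eq_x, reassoc_of% hr, hK.lift_fst]
  · rw [Category.assoc, hQ.eq_t]

theorem AxiomStar.exists_comp_eq_comp_lift_zero [Regular D] [HasZeroMorphisms D]
    (hS : AxiomStar D) {X V : D} {h : X ⨯ X ⟶ V} (hh : diag X ≫ h = 0) :
    ∃ (E : D) (e : E ⟶ X ⨯ X) (z : E ⟶ X),
      IsRegularEpi e ∧ e ≫ h = z ≫ prod.lift 0 (𝟙 X) ≫ h := by
  have jm : JointlyMono₂ (prod.fst : X ⨯ X ⟶ X) prod.snd := ⟨fun _ _ _ => prod.hom_ext⟩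
  have hT := IsKernelPair.of_hasPullback h
  obtain ⟨E, e, δ, he, hδ, hr⟩ := hS.exists_cover (π₀ := prod.fst)
    ⟨prod.lift 0 (𝟙 X), prod.lift_snd _ _, prod.lift_fst _ _⟩ (isDifunctional_fst_snd X X)
    (isEquivalenceRelation_of_isKernelPair hT) (a := 𝟙 (X ⨯ X)) (b := prod.fst ≫ diag X) (c := 0)
    (by simp)
    ((rel_iff_of_isKernelPair hT _ _).2 (by rw [Category.assoc, hh, comp_zero, zero_comp]))
  have hδ' : δ = (δ ≫ prod.snd) ≫ prod.lift 0 (𝟙 X) :=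
    prod.hom_ext (by simpa using hδ) (by simp)
  have hδh : (e ≫ 𝟙 (X ⨯ X)) ≫ h = δ ≫ h := (rel_iff_of_isKernelPair hT _ _).1 hr
  refine ⟨E, e, δ ≫ prod.snd, he, ?_⟩
  rw [← Category.assoc _ _ h, ← hδ', ← hδh, Category.comp_id]

end Star

section Abelian

variable {D : Type u} [Category.{v} D] [HasZeroMorphisms D]

-- Here `d(x, y)` stands for `y - x`, whereas it is `x - y` in `Subtraction`: this order matches the
-- comparison map `(0, 1) : X ⟶ X ⨯ X`.
theorem isAbelian_iff [HasBinaryProducts D] {X : D} :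
    IsAbelian X ↔ ∃ d : X ⨯ X ⟶ X, diag X ≫ d = 0 ∧ prod.lift 0 (𝟙 X) ≫ d = 𝟙 X := by
  constructor
  · rintro ⟨S⟩
    let swap : X ⨯ X ⟶ S.XX := S.isProduct.lift (BinaryFan.mk prod.snd prod.fst)
    have swap_p₀ : swap ≫ S.p₀ = prod.snd := S.isProduct.fac _ ⟨WalkingPair.left⟩
    have swap_p₁ : swap ≫ S.p₁ = prod.fst := S.isProduct.fac _ ⟨WalkingPair.right⟩
    refine ⟨swap ≫ S.d, ?_, ?_⟩
    · rw [← Category.assoc, S.d_self _ (by simp [swap_p₀, swap_p₁])]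
    · rw [← Category.assoc, S.d_zero _ (by simp [swap_p₁])]
      simp [swap_p₀]
  · rintro ⟨d, hself, hzero⟩
    refine ⟨⟨X ⨯ X, prod.fst, prod.snd, prodIsProd X X, prod.lift prod.snd prod.fst ≫ d,
      fun A u hu => ?_, fun A u hu => ?_⟩⟩
    · have : u ≫ prod.lift prod.snd prod.fst = (u ≫ prod.fst) ≫ diag X := by simp [hu]
      rw [reassoc_of% this, hself, comp_zero, comp_zero]
    · have : u ≫ prod.lift prod.snd prod.fst = (u ≫ prod.fst) ≫ prod.lift 0 (𝟙 X) := by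
        simp [hu]
      rw [reassoc_of% this, hzero, Category.comp_id]

theorem IsGumm.lift_comp_eq_of_diag_comp_eq_zero [HasPullbacks D] [HasBinaryProducts D]
    (hG : IsGumm D) {X V : D} {ω : X ⨯ X ⟶ V} (hω : diag X ≫ ω = 0) {A : D} {x x' y y' : A ⟶ X}
    (hx : x ≫ prod.lift 0 (𝟙 X) ≫ ω = x' ≫ prod.lift 0 (𝟙 X) ≫ ω)
    (hy : y ≫ prod.lift 0 (𝟙 X) ≫ ω = y' ≫ prod.lift 0 (𝟙 X) ≫ ω) :
    prod.lift x y ≫ ω = prod.lift x' y' ≫ ω := by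
  have lift_self (z : A ⟶ X) : prod.lift z z ≫ ω = 0 := by
    have : prod.lift z z = z ≫ diag X := by simp
    rw [this, Category.assoc, hω, comp_zero]
  simp only [prod.comp_lift_assoc, comp_zero, Category.comp_id] at hx hy
  have hxx' : prod.lift x x ≫ ω = prod.lift x' x ≫ ω :=
    calc prod.lift x x ≫ ω = prod.lift x' x' ≫ ω := by rw [lift_self, lift_self]
      _ = prod.lift x' x ≫ ω := hG.lift_comp_eq_of_snd ω hx.symm
  calc prod.lift x y ≫ ω = prod.lift x' y ≫ ω := hG.lift_comp_eq_of_fst ω hxx'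
    _ = prod.lift x' y' ≫ ω := hG.lift_comp_eq_of_snd ω hy

variable [Regular D]

theorem AxiomStar.isAbelian_of_mono (hS : AxiomStar D) {U A : D} (m : U ⟶ A) [Mono m]
    (hA : IsAbelian A) : IsAbelian U := by
  obtain ⟨d, hself, hzero⟩ := isAbelian_iff.1 hA
  obtain ⟨E, e, z, _, hz⟩ := hS.exists_comp_eq_comp_lift_zero (h := prod.map m m ≫ d)
    (by rw [prod.diag_map_assoc, hself, comp_zero])
  have hm : prod.lift 0 (𝟙 U) ≫ prod.map m m ≫ d = m := by
    have : prod.lift 0 (𝟙 U) ≫ prod.map m m = m ≫ prod.lift 0 (𝟙 A) := by simp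
    rw [reassoc_of% this, hzero, Category.comp_id]
  have sq : CommSq z e m (prod.map m m ≫ d) := ⟨by rw [hz, hm]⟩
  refine isAbelian_iff.2 ⟨sq.lift, ?_, ?_⟩
  · rw [← cancel_mono m, Category.assoc, sq.fac_right, prod.diag_map_assoc, hself, comp_zero,
      zero_comp]
  · rw [← cancel_mono m, Category.assoc, sq.fac_right, hm, Category.id_comp]

theorem AxiomStar.isRegularEpi_lift_zero_comp (hS : AxiomStar D) {X V : D} {h : X ⨯ X ⟶ V}
    [IsRegularEpi h] (hh : diag X ≫ h = 0) : IsRegularEpi (prod.lift 0 (𝟙 X) ≫ h) := by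
  obtain ⟨E, e, z, _, hz⟩ := hS.exists_comp_eq_comp_lift_zero hh
  have : StrongEpi (z ≫ prod.lift 0 (𝟙 X) ≫ h) := hz ▸ strongEpi_comp e h
  have := strongEpi_of_strongEpi z (prod.lift 0 (𝟙 X) ≫ h)
  infer_instance

end Abelian

section Punctuation

variable {D : Type u} [Category.{v} D] [HasZeroObject D] [HasZeroMorphisms D]

open scoped ZeroObject

namespace IsDiagonalPunctuation

variable {X XX Dp : D} {p₀ p₁ : XX ⟶ X} {s₀ : X ⟶ XX} {ω : XX ⟶ Dp}

theorem comp_eq_zero (h : IsDiagonalPunctuation p₀ p₁ s₀ ω) : s₀ ≫ ω = 0 := by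
  rw [h.isPushout.w, zero_comp]

theorem exists_desc (h : IsDiagonalPunctuation p₀ p₁ s₀ ω) {Z : D} (k : XX ⟶ Z)
    (hk : s₀ ≫ k = 0) : ∃ l : Dp ⟶ Z, ω ≫ l = k :=
  ⟨h.isPushout.desc k 0 (by rw [hk, zero_comp]), h.isPushout.inl_desc _ _ _⟩

theorem isRegularEpi (h : IsDiagonalPunctuation p₀ p₁ s₀ ω) : IsRegularEpi ω := by
  have : IsSplitEpi (0 : X ⟶ (0 : D)) := ⟨⟨0, (isZero_zero D).eq_of_src _ _⟩⟩
  exact isRegularEpi_of_regularEpi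
    (regularOfIsPushoutSndOfRegular (RegularEpi.ofSplitEpi 0) h.isPushout.w h.isPushout.isColimit)

theorem exists_iso [HasBinaryProducts D] (h : IsDiagonalPunctuation p₀ p₁ s₀ ω) :
    ∃ e : X ⨯ X ≅ XX, e.hom ≫ p₀ = prod.fst ∧ e.hom ≫ p₁ = prod.snd ∧
      IsDiagonalPunctuation prod.fst prod.snd (diag X) (e.hom ≫ ω) := by
  obtain ⟨hX⟩ := h.isProduct
  let e : X ⨯ X ≅ XX := (prodIsProd X X).conePointUniqueUpToIso hX
  have he₀ : e.hom ≫ p₀ = prod.fst :=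
    IsLimit.conePointUniqueUpToIso_hom_comp _ hX ⟨WalkingPair.left⟩
  have he₁ : e.hom ≫ p₁ = prod.snd :=
    IsLimit.conePointUniqueUpToIso_hom_comp _ hX ⟨WalkingPair.right⟩
  have hs : s₀ = diag X ≫ e.hom := BinaryFan.IsLimit.hom_ext hX
    (by simp [he₀, h.s₀_p₀]) (by simp [he₁, h.s₀_p₁])
  exact ⟨e, he₀, he₁, ⟨prodIsProd X X⟩, by simp, by simp,
    h.isPushout.of_iso' (Iso.refl _) e (Iso.refl _) (Iso.refl _)
      (by simp [hs]) (by simp) (by simp) (by simp)⟩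

theorem exists_comp_eq [HasBinaryProducts D] {ω : X ⨯ X ⟶ Dp}
    (h : IsDiagonalPunctuation prod.fst prod.snd (diag X) ω) {A : D} (hA : IsAbelian A)
    (f : X ⟶ A) : ∃ k : Dp ⟶ A, (prod.lift 0 (𝟙 X) ≫ ω) ≫ k = f := by
  obtain ⟨d, hself, hzero⟩ := isAbelian_iff.1 hA
  obtain ⟨k, hk⟩ := h.exists_desc (prod.map f f ≫ d)
    (by rw [prod.diag_map_assoc, hself, comp_zero])
  have : prod.lift 0 (𝟙 X) ≫ prod.map f f = f ≫ prod.lift 0 (𝟙 A) := by simp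
  exact ⟨k, by rw [Category.assoc, hk, reassoc_of% this, hzero, Category.comp_id]⟩

end IsDiagonalPunctuation

variable [Regular D] {X Dp : D} {ω : X ⨯ X ⟶ Dp}

theorem IsDiagonalPunctuation.exists_prod_map_comp_eq (hG : IsGumm D) (hS : AxiomStar D)
    (h : IsDiagonalPunctuation prod.fst prod.snd (diag X) ω) :
    ∃ d : Dp ⨯ Dp ⟶ Dp,
      prod.map (prod.lift 0 (𝟙 X) ≫ ω) (prod.lift 0 (𝟙 X) ≫ ω) ≫ d = ω := by
  set η := prod.lift 0 (𝟙 X) ≫ ω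
  have := h.isRegularEpi
  have : IsRegularEpi η := hS.isRegularEpi_lift_zero_comp h.comp_eq_zero
  have := isRegularEpi_prod_map_self η
  refine ⟨IsRegularEpi.desc (prod.map η η) ω ?_, IsRegularEpi.fac _ _ _⟩
  let u := IsRegularEpi.left (prod.map η η)
  let v := IsRegularEpi.right (prod.map η η)
  have hw : u ≫ prod.map η η = v ≫ prod.map η η := IsRegularEpi.w (prod.map η η)
  have := hG.lift_comp_eq_of_diag_comp_eq_zero h.comp_eq_zero
    (x := u ≫ prod.fst) (x' := v ≫ prod.fst) (y := u ≫ prod.snd) (y' := v ≫ prod.snd)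
    (by simpa using hw =≫ prod.fst) (by simpa using hw =≫ prod.snd)
  simpa only [← prod.comp_lift, prod.lift_fst_snd, Category.comp_id] using this

theorem IsDiagonalPunctuation.isAbelian (hG : IsGumm D) (hS : AxiomStar D)
    (h : IsDiagonalPunctuation prod.fst prod.snd (diag X) ω) : IsAbelian Dp := by
  obtain ⟨d, hd⟩ := h.exists_prod_map_comp_eq hG hS
  set η := prod.lift 0 (𝟙 X) ≫ ω
  have := h.isRegularEpi
  have : IsRegularEpi η := hS.isRegularEpi_lift_zero_comp h.comp_eq_zero
  refine isAbelian_iff.2 ⟨d, ?_, ?_⟩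
  · rw [← cancel_epi η, ← prod.diag_map_assoc, hd, h.comp_eq_zero, comp_zero]
  · have : η ≫ prod.lift 0 (𝟙 Dp) = prod.lift 0 (𝟙 X) ≫ prod.map η η := by simp
    rw [← cancel_epi η, reassoc_of% this, hd, Category.comp_id]

theorem IsDiagonalPunctuation.isUniversalAbelian (hG : IsGumm D) (hS : AxiomStar D)
    (h : IsDiagonalPunctuation prod.fst prod.snd (diag X) ω) :
    IsUniversalAbelian (prod.lift 0 (𝟙 X) ≫ ω) where
  isAbelian := h.isAbelian hG hS
  existsUnique_desc A hA f := by
    obtain ⟨k, hk⟩ := h.exists_comp_eq hA f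
    have := h.isRegularEpi
    have := hS.isRegularEpi_lift_zero_comp h.comp_eq_zero
    exact ⟨k, hk, fun l hl => by rw [← cancel_epi (prod.lift 0 (𝟙 X) ≫ ω), hk, hl]⟩

end Punctuation

section CreatesCoequalizers

variable {C : Type u} [Category.{v} C] [Regular C] {D : Type u'} [Category.{v'} D]

theorem hasColimit_parallelPair_comp_of_isKernelPair (F : D ⥤ C)
    [PreservesLimitsOfShape WalkingCospan F] {K X Y : D} {f : X ⟶ Y} {k₀ k₁ : K ⟶ X}
    (hk : IsKernelPair f k₀ k₁) : HasColimit (parallelPair k₀ k₁ ⋙ F) :=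
  have : HasCoequalizer (F.map k₀) (F.map k₁) :=
    Regular.hasCoequalizer_of_isKernelPair (f := F.map f) (IsPullback.map F hk)
  hasColimit_of_iso (F := parallelPair (F.map k₀) (F.map k₁)) (diagramIsoParallelPair _)

theorem isRegularEpi_map_iff [HasPullbacks D] (F : D ⥤ C)
    [PreservesLimitsOfShape WalkingCospan F] [CreatesColimitsOfShape WalkingParallelPair F]
    {X Y : D} (f : X ⟶ Y) : IsRegularEpi (F.map f) ↔ IsRegularEpi f := by
  have hk := IsKernelPair.of_hasPullback f
  have hFk : IsKernelPair (F.map f) _ _ := IsPullback.map F hk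
  have := hasColimit_parallelPair_comp_of_isKernelPair F hk
  constructor <;> intro
  · exact isRegularEpi_of_regularEpi <| Cofork.IsColimit.regularEpi <|
      isColimitOfIsColimitCoforkMap F hk.w hFk.toCoequalizer'
  · exact isRegularEpi_of_regularEpi <| Cofork.IsColimit.regularEpi <|
      isColimitCoforkMapOfIsColimit F hk.w hk.toCoequalizer'

theorem regular_of_createsCoequalizers [HasFiniteLimits D] (F : D ⥤ C)
    [PreservesLimitsOfShape WalkingCospan F] [CreatesColimitsOfShape WalkingParallelPair F] :
    Regular D where
  hasCoequalizer_of_isKernelPair hk :=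
    have := hasColimit_parallelPair_comp_of_isKernelPair F hk
    hasColimit_of_created _ F
  regularEpiIsStableUnderBaseChange :=
    ⟨fun sq hg => (isRegularEpi_map_iff F _).1 <|
      Regular.regularEpiIsStableUnderBaseChange.of_isPullback (sq.map F)
        ((isRegularEpi_map_iff F _).2 hg)⟩

end CreatesCoequalizers

namespace Pt

open scoped ZeroObject

variable {C : Type u} [Category.{v} C] (Y : C)

/-- `Pt_Y C` as the category of objects under the terminal object `𝟙 Y` of `Over Y`; this is how
`Pt_Y C` inherits limits and colimits from `C`. -/
def toUnder : Pt Y ⥤ Under (Over.mk (𝟙 Y)) where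
  obj P := Under.mk (Over.homMk P.σ P.σ_π : Over.mk (𝟙 Y) ⟶ Over.mk P.π)
  map f := Under.homMk (Over.homMk f.hom f.hom_π) (Over.OverMorphism.ext f.σ_hom)

instance : (toUnder Y).IsEquivalence where
  faithful := ⟨fun h => Hom.ext (congrArg (fun f => f.right.left) h)⟩
  full := ⟨fun f => ⟨⟨f.right.left, Over.w f.right, congrArg CommaMorphism.left (Under.w f)⟩, rfl⟩⟩
  essSurj := ⟨fun A => ⟨⟨A.right.left, A.right.hom, A.hom.left, Over.w A.hom⟩, ⟨Iso.refl _⟩⟩⟩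

/-- The functor to `C` keeping only the total object of a split epimorphism. -/
def forget : Pt Y ⥤ C := toUnder Y ⋙ Under.forget _ ⋙ Over.forget Y

noncomputable instance : CreatesColimitsOfShape WalkingParallelPair (forget Y) :=
  inferInstanceAs <| CreatesColimitsOfShape _ (toUnder Y ⋙ Under.forget _ ⋙ Over.forget Y)

theorem rel_hom_of_rel {Y : C} {X A R : Pt Y} {r₀ r₁ : R ⟶ X} {x y : A ⟶ X} (h : Rel r₀ r₁ x y) :
    Rel r₀.hom r₁.hom x.hom y.hom := by
  obtain ⟨r, rfl, rfl⟩ := h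
  exact ⟨r.hom, rfl, rfl⟩

variable [HasFiniteLimits C]

instance : HasFiniteLimits (Pt Y) :=
  have := hasFiniteLimits_of_hasLimitsLimits_of_createsFiniteLimits (Under.forget (Over.mk (𝟙 Y)))
  ⟨fun _ _ _ => Adjunction.hasLimitsOfShape_of_equivalence (toUnder Y)⟩

instance : PreservesLimitsOfShape WalkingCospan (forget Y) :=
  inferInstanceAs <| PreservesLimitsOfShape _ (toUnder Y ⋙ Under.forget _ ⋙ Over.forget Y)

instance : PreservesColimitsOfShape WalkingSpan (forget Y) :=
  have : PreservesColimitsOfShape WalkingSpan (Over.forget Y) :=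
    (Over.forgetAdjStar Y).leftAdjoint_preservesColimits.preservesColimitsOfShape
  inferInstanceAs <| PreservesColimitsOfShape _ (toUnder Y ⋙ Under.forget _ ⋙ Over.forget Y)

section

variable {Y}

theorem isKernelPair_of_isLimit {X XX : Pt Y} {d₀ d₁ : XX ⟶ X}
    (h : IsLimit (BinaryFan.mk d₀ d₁)) : IsKernelPair X.π d₀.hom d₁.hom := by
  have zeroIsTerminal : IsTerminal (0 : Pt Y) := HasZeroObject.zeroIsTerminal
  have sq : IsPullback d₀ d₁ (zeroIsTerminal.from X) (zeroIsTerminal.from X) :=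
    IsPullback.of_isLimit_binaryFan_of_isTerminal h zeroIsTerminal
  rw [zeroIsTerminal.hom_ext (zeroIsTerminal.from X) 0] at sq
  exact IsKernelPair.cancel_right (f₁ := X.π) (f₂ := (0 : Pt Y).σ) (d₀.hom_π.trans d₁.hom_π.symm)
    (sq.map (forget Y))

theorem prod_lift_hom_fst_hom {X A : Pt Y} (x y : A ⟶ X) :
    (prod.lift x y).hom ≫ (prod.fst : X ⨯ X ⟶ X).hom = x.hom :=
  congrArg Hom.hom (prod.lift_fst x y)

theorem prod_lift_hom_snd_hom {X A : Pt Y} (x y : A ⟶ X) :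
    (prod.lift x y).hom ≫ (prod.snd : X ⨯ X ⟶ X).hom = y.hom :=
  congrArg Hom.hom (prod.lift_snd x y)

theorem jointlyMono₂_hom {X R : Pt Y} (r₀ r₁ : R ⟶ X) [JointlyMono₂ r₀ r₁] :
    JointlyMono₂ r₀.hom r₁.hom := by
  have : Mono (prod.lift r₀ r₁) := ⟨fun f g e => JointlyMono₂.right_cancellation (p₁ := r₀)
    (p₂ := r₁) _ _ (by simpa using e =≫ prod.fst) (by simpa using e =≫ prod.snd)⟩
  have : Mono (prod.lift r₀ r₁).hom := inferInstanceAs (Mono ((forget Y).map (prod.lift r₀ r₁)))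
  have hX := isKernelPair_of_isLimit (prodIsProd X X)
  refine ⟨fun A f g e₀ e₁ => ?_⟩
  rw [← cancel_mono (prod.lift r₀ r₁).hom]
  exact hX.hom_ext (by simpa [prod_lift_hom_fst_hom] using e₀)
    (by simpa [prod_lift_hom_snd_hom] using e₁)

theorem isEquivalenceRelation_hom {X R : Pt Y} {r₀ r₁ : R ⟶ X}
    (h : IsEquivalenceRelation r₀ r₁) : IsEquivalenceRelation r₀.hom r₁.hom := by
  obtain ⟨⟨e⟩⟩ := h
  have := e.toJointlyMono₂
  have : JointlyMono₂ ((forget Y).map r₀) ((forget Y).map r₁) := jointlyMono₂_hom r₀ r₁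
  exact ⟨⟨{ e.toReflexiveRelation.map (forget Y),
    e.toSymmetricRelation.map (forget Y), e.toTransitiveRelation.map (forget Y) with }⟩⟩

theorem rel_of_rel_hom {X A T : Pt Y} {t₀ t₁ : T ⟶ X} [JointlyMono₂ t₀ t₁]
    {x y : A ⟶ X} (h : Rel t₀.hom t₁.hom x.hom y.hom) : Rel t₀ t₁ x y := by
  obtain ⟨t, ht₀, ht₁⟩ := h
  have := jointlyMono₂_hom t₀ t₁
  refine ⟨⟨t, ?_, JointlyMono₂.right_cancellation (p₁ := t₀.hom) (p₂ := t₁.hom) _ _ ?_ ?_⟩,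
    Hom.ext ht₀, Hom.ext ht₁⟩
  · rw [← t₀.hom_π, reassoc_of% ht₀, x.hom_π]
  · rw [Category.assoc, ht₀, x.σ_hom, t₀.σ_hom]
  · rw [Category.assoc, ht₁, y.σ_hom, t₁.σ_hom]

-- The elements `A ⟶ X.obj` of `C` are not elements of `X` in `Pt Y`, so the inclusion is tested
-- on the generic element of `R ∩ S`, which does live in `Pt Y`.
theorem rel_hom_of_forall_rel {X R S T : Pt Y} {r₀ r₁ : R ⟶ X} {s₀ s₁ : S ⟶ X} {t₀ t₁ : T ⟶ X}
    (h : ∀ ⦃A : Pt Y⦄ (x y : A ⟶ X), Rel r₀ r₁ x y → Rel s₀ s₁ x y → Rel t₀ t₁ x y)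
    {A : C} {x y : A ⟶ X.obj} (hr : Rel r₀.hom r₁.hom x y) (hs : Rel s₀.hom s₁.hom x y) :
    Rel t₀.hom t₁.hom x y := by
  obtain ⟨r, rfl, rfl⟩ := hr
  obtain ⟨s, hs₀, hs₁⟩ := hs
  let f := prod.lift r₀ r₁
  let g := prod.lift s₀ s₁
  have w : pullback.fst f g ≫ f = pullback.snd f g ≫ g := pullback.condition
  have generic_mem_T : Rel t₀ t₁ (pullback.fst f g ≫ r₀) (pullback.fst f g ≫ r₁) :=
    h _ _ ⟨_, rfl, rfl⟩ ⟨pullback.snd f g, by simpa [f, g] using (w =≫ prod.fst).symm,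
      by simpa [f, g] using (w =≫ prod.snd).symm⟩
  obtain ⟨t, ht₀, ht₁⟩ := rel_hom_of_rel generic_mem_T
  have hP : IsPullback (pullback.fst f g).hom (pullback.snd f g).hom f.hom g.hom :=
    (IsPullback.of_hasPullback f g).map (forget Y)
  have e : r ≫ f.hom = s ≫ g.hom :=
    (isKernelPair_of_isLimit (prodIsProd X X)).hom_ext
      (by simp only [Category.assoc, f, g, prod_lift_hom_fst_hom, hs₀])
      (by simp only [Category.assoc, f, g, prod_lift_hom_snd_hom, hs₁])
  refine ⟨hP.lift r s e ≫ t, ?_, ?_⟩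
  · rw [Category.assoc, ht₀]
    exact hP.lift_fst_assoc r s e r₀.hom
  · rw [Category.assoc, ht₁]
    exact hP.lift_fst_assoc r s e r₁.hom

theorem isGumm (hG : IsGumm C) : IsGumm (Pt Y) := by
  intro X R S T r₀ r₁ s₀ s₁ t₀ t₁ hR hS hT hRST A x y x' y' hxy hxy' hxx' hyy' hT'
  have : JointlyMono₂ t₀ t₁ := hT.nonempty_equivalenceRelation.some.toJointlyMono₂
  exact rel_of_rel_hom <| hG _ _ _ _ _ _ (isEquivalenceRelation_hom hR)
    (isEquivalenceRelation_hom hS) (isEquivalenceRelation_hom hT)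
    (fun _ _ _ => rel_hom_of_forall_rel hRST) _ _ _ _ (rel_hom_of_rel hxy) (rel_hom_of_rel hxy')
    (rel_hom_of_rel hxx') (rel_hom_of_rel hyy') (rel_hom_of_rel hT')

theorem isPushout_hom {X XX Dp : Pt Y} {s₀ : X ⟶ XX} {ω : XX ⟶ Dp}
    (h : IsPushout s₀ (0 : X ⟶ (0 : Pt Y)) ω (0 : (0 : Pt Y) ⟶ Dp)) :
    IsPushout s₀.hom X.π ω.hom Dp.σ := by
  let e : (0 : Pt Y).obj ≅ Y := ⟨(0 : Pt Y).π, (0 : Pt Y).σ,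
    congrArg Hom.hom ((isZero_zero (Pt Y)).eq_of_src 0 (𝟙 _)), (0 : Pt Y).σ_π⟩
  have sq : IsPushout s₀.hom (X.π ≫ (0 : Pt Y).σ) ω.hom ((0 : Pt Y).π ≫ Dp.σ) :=
    h.map (forget Y)
  exact sq.of_iso (Iso.refl _) (Iso.refl _) e (Iso.refl _) (by simp) (by simp [e, (0 : Pt Y).σ_π])
    (by simp) (by simp [e])

end

instance regular {C : Type u} [Category.{v} C] [Regular C] (Y : C) : Regular (Pt Y) :=
  regular_of_createsCoequalizers (forget Y)

end Pt

end GummCat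

theorem mainTheorem2_general {C : Type*} [Category* C] [Regular C]
    (hGumm : GummCat.IsGumm C) {Y : C} (hStar : GummCat.AxiomStar (GummCat.Pt Y)) :
    (∀ (X XX Dp : GummCat.Pt Y) (d₀ d₁ : XX ⟶ X) (s₀ : X ⟶ XX) (ω : XX ⟶ Dp),
      GummCat.IsDiagonalPunctuation d₀ d₁ s₀ ω →
        IsKernelPair X.π d₀.hom d₁.hom ∧
        IsPushout s₀.hom X.π ω.hom Dp.σ ∧
        IsRegularEpi ω.hom ∧
        ∃ ι : X ⟶ XX, ι ≫ d₀ = 0 ∧ ι ≫ d₁ = 𝟙 X ∧ GummCat.IsUniversalAbelian (ι ≫ ω)) ∧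
    (∀ (U A : GummCat.Pt Y) (m : U ⟶ A), Mono m →
      GummCat.IsAbelian A → GummCat.IsAbelian U) := by
  refine ⟨fun X XX Dp d₀ d₁ s₀ ω h => ⟨GummCat.Pt.isKernelPair_of_isLimit h.isProduct.some,
    GummCat.Pt.isPushout_hom h.isPushout,
    (GummCat.isRegularEpi_map_iff (GummCat.Pt.forget Y) ω).2 h.isRegularEpi, ?_⟩,
    fun U A m _ hA => hStar.isAbelian_of_mono m hA⟩
  obtain ⟨e, he₀, he₁, he⟩ := h.exists_iso
  refine ⟨prod.lift 0 (𝟙 X) ≫ e.hom, ?_, ?_, ?_⟩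
  · rw [Category.assoc, he₀, prod.lift_fst]
  · rw [Category.assoc, he₁, prod.lift_snd]
  · rw [Category.assoc]
    exact he.isUniversalAbelian (GummCat.Pt.isGumm hGumm) hStar

theorem mainTheorem2 {C : Type*} [Category* C] [Regular C]
    (hGumm : GummCat.IsGumm C)
    (hStar : ∀ Y : C, GummCat.AxiomStar (GummCat.Pt Y))
    (hDp : ∀ Y : C, GummCat.HasDiagonalPunctuations (GummCat.Pt Y)) :
    (∀ (Y : C) (X XX Dp : GummCat.Pt Y) (d₀ d₁ : XX ⟶ X) (s₀ : X ⟶ XX) (ω : XX ⟶ Dp),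
      GummCat.IsDiagonalPunctuation d₀ d₁ s₀ ω →
        -- the underlying square in `C`: `R[f]` is the kernel pair of `f`, and the square is the
        -- pushout of `s₀` along `f`, with `ω` a regular epimorphism
        IsKernelPair X.π d₀.hom d₁.hom ∧
        IsPushout s₀.hom X.π ω.hom Dp.σ ∧
        IsRegularEpi ω.hom ∧
        -- `Dp = (ψ, θ)` is the universal abelian split epimorphism associated with `X = (f, s)`,
        -- the universal comparison being `ω.(s.f, 1)`
        ∃ ι : X ⟶ XX, ι ≫ d₀ = 0 ∧ ι ≫ d₁ = 𝟙 X ∧ GummCat.IsUniversalAbelian (ι ≫ ω)) ∧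
    (∀ (Y : C) (U A : GummCat.Pt Y) (m : U ⟶ A), Mono m →
      GummCat.IsAbelian A → GummCat.IsAbelian U) :=
  ⟨fun Y => (mainTheorem2_general hGumm (hStar Y)).1,
    fun Y => (mainTheorem2_general hGumm (hStar Y)).2⟩
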